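/- **Setting.** Let $I$ be a nonempty index set of domains (for instance $I=[N]=\{1,\dots,N\}$) and $d_C,d_S,d\ge 0$ integers. Let $\mathcal C\subseteq\mathbb R^{d_C}$ and $\mathcal S^{(n)}\subseteq\mathbb R^{d_S}$ ($n\in I$) be open and simply connected, $\mathcal S=\bigcup_{n}\mathcal S^{(n)}$, and let $g:\mathcal C\times\mathcal S\to\mathbb R^d$ be differentiable and injective; put $\mathcal X^{(n)}=g(\mathcal C\times\mathcal S^{(n)})$ and $\mathcal X=\bigcup_n\mathcal X^{(n)}$. For each $n$ let $(c,s^{(n)})$ be a random pair in $\mathcal C\times\mathcal S^{(n)}$ with joint law $\mathbb P_n$, possibly dependent, such that the law of $c$ is the same for all $n$ and $\mathbb P_n$ has a finite, strictly positive density on $\mathcal C\times\mathcal S^{(n)}$. The data of domain $n$ are $x^{(n)}=g(c,s^{(n)})$. Assume *domain variability*: whenever $A\subseteq\mathcal C\times\mathcal S$ is measurable with $\mathbb P_n[A]>0$ for all $n$, and there is no $B\subseteq\mathcal C$ such that $A$ and $B\times\mathcal S$ differ by a set that is $\mathbb P_n$-null for every $n$, there are $i,j\in I$ with $\mathbb P_i[A]\ne\mathbb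 P_j[A]$. Write $J_c,J_s$ for the partial Jacobians with respect to the content and style blocks, $\mathcal R(\cdot)$ for the range, $\|\cdot\|_2$ for the spectral norm, and $\sigma_{\min}$ for the smallest singular value (of the $d_S$ singular values of a $d\times d_S$ matrix). **Learned model.** Let $\widehat{\mathcal C}\subseteq\mathbb R^{d_C}$ and $\widehat{\mathcal S}^{(n)}\subseteq\mathbb R^{d_S}$ be open and simply connected, $\widehat{\mathcal S}=\bigcup_n\widehat{\mathcal S}^{(n)}$, and let $\widehat g:\widehat{\mathcal C}\times\widehat{\mathcal S}\to\mathcal X$ be a differentiable bijection that maps $\widehat{\mathcal C}\times\widehat{\mathcal S}^{(n)}$ onto $\mathcal X^{(n)}$ for each $n$ and whose inverse is differentiable on $\mathcal X$. Suppose that for some random pairs in $\widehat{\mathcal C}\times\widehat{\mathcal S}^{(n)}$, $n \in I$, whose content components have the same law for all $n$, the image under $\widehat g$ of the $n$-th pair has the law of $x^{(n)}$ for every $n$, and that $\mathcal R(J_{\widehat c}\,\widehat g)\perp\mathcal R(J_{\widehat s}\,\widehat g)$ at every point of $\widehat{\mathcal C}\times\widehat{\mathcal S}^{(n)}$, for every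 $n$. For $(c,s)\in\mathcal C\times\mathcal S$ let $(\widehat c,\widehat s)=\widehat g^{-1}(g(c,s))$ be the learned content and style. **Theorem (Robustness of Identifiability).** Let $\xi\in[0,\pi/2]$. Suppose that for every $n$ and every $(c,s)\in\mathcal C\times\mathcal S^{(n)}$ the smallest principal angle between $\mathcal R(J_cg(c,s))$ and $\mathcal R(J_sg(c,s))$ is at least $\pi/2-\xi$ (understood to hold if one of these subspaces is zero), and that $\operatorname{rank}J_sg(c,s)=d_S$. Then: (a) There is a bijection $\gamma:\mathcal C\to\widehat{\mathcal C}$ with $\widehat c=\gamma(c)$ for all $n$ and all $(c,s)\in\mathcal C\times\mathcal S^{(n)}$. (b) There is a map $\delta$ on $\mathcal C\times\mathcal S$ such that, for every $n$ and every $(c,s)\in\mathcal C\times\mathcal S^{(n)}$, one has $\widehat s=\delta(c,s)\in\widehat{\mathcal S}^{(n)}$, $\delta$ is differentiable at $(c,s)$, $\sigma_{\min}\big(J_{\widehat s}\,\widehat g(\widehat c,\widehat s)\big)>0$ if $d_S>0$, and $$\|J_c\delta(c,s)\|_2\;\le\;\frac{\sin\xi}{\sigma_{\min}\big(J_{\widehat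 s}\,\widehat g(\widehat c,\widehat s)\big)}\;\|J_cg(c,s)\|_2$$ (for $d_S=0$ the left side is $0$ and the inequality is void). -/

import Mathlib

noncomputable section

open MeasureTheory Set

namespace ContentStyle

/-- `ℝᵏ` with its Euclidean norm. -/
abbrev Vec (k : ℕ) : Type := EuclideanSpace ℝ (Fin k)

/-- The partial Jacobian with respect to the first (content) block. Its norm is the operator norm
between Euclidean spaces, i.e. the spectral norm. -/
def contentJac {p q r : ℕ} (F : Vec p × Vec q → Vec r) (z : Vec p × Vec q) : Vec p →L[ℝ] Vec r :=
  fderiv ℝ (fun c => F (c, z.2)) z.1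

/-- The partial Jacobian with respect to the second (style) block. -/
def styleJac {p q r : ℕ} (F : Vec p × Vec q → Vec r) (z : Vec p × Vec q) : Vec q →L[ℝ] Vec r :=
  fderiv ℝ (fun s => F (z.1, s)) z.2

/-- The range `R(J)` of a Jacobian. -/
def jacRange {p r : ℕ} (J : Vec p →L[ℝ] Vec r) : Submodule ℝ (Vec r) :=
  LinearMap.range (J : Vec p →ₗ[ℝ] Vec r)

/-- The smallest of the `p` singular values of a linear map `ℝᵖ → ℝʳ` (they are listed in
decreasing order, starting from index `0`). -/
def sigmaMin {p r : ℕ} (J : Vec p →L[ℝ] Vec r) : ℝ :=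
  (J : Vec p →ₗ[ℝ] Vec r).singularValues (p - 1)

/-- The smallest principal angle between two subspaces: the least angle between a nonzero vector of
the first and a nonzero vector of the second. It never exceeds `π / 2`, because `u` can be replaced
by `-u`; the value `π / 2` is inserted so that the angle is `π / 2`, and not the infimum of the empty
set, if one of the subspaces is zero. -/
def smallestPrincipalAngle {r : ℕ} (U V : Submodule ℝ (Vec r)) : ℝ :=
  sInf (insert (Real.pi / 2)
    {θ : ℝ | ∃ u ∈ U, ∃ v ∈ V, u ≠ 0 ∧ v ≠ 0 ∧ θ = InnerProductGeometry.angle u v})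

/-- The data of a multi-domain content-style model with domains indexed by `ι`: the content space,
the style space of each domain, the generator (only its values on latent points matter), and for each
domain `n` the joint law of the latent pair (content, style of domain `n`). -/
structure Model (ι : Type*) (dC dS d : ℕ) where
  content : Set (Vec dC)
  style : ι → Set (Vec dS)
  generator : Vec dC × Vec dS → Vec d
  law : ι → Measure (Vec dC × Vec dS)

namespace Model

variable {ι : Type*} {dC dS d : ℕ}

/-- The union of the style spaces of all domains. -/
def allStyle (M : Model ι dC dS d) : Set (Vec dS) := ⋃ n, M.style n

/-- The latent space of domain `n`. -/
def latent (M : Model ι dC dS d) (n : ι) : Set (Vec dC × Vec dS) := M.content ×ˢ M.style n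

/-- The latent space of all domains together. -/
def allLatent (M : Model ι dC dS d) : Set (Vec dC × Vec dS) := M.content ×ˢ M.allStyle

/-- The data manifold of domain `n`. -/
def data (M : Model ι dC dS d) (n : ι) : Set (Vec d) := M.generator '' M.latent n

/-- The data manifold of all domains together. -/
def allData (M : Model ι dC dS d) : Set (Vec d) := M.generator '' M.allLatent

/-- The inverse of the generator (meaningful on `M.allData` if the generator is injective). -/
def inverse (M : Model ι dC dS d) : Vec d → Vec dC × Vec dS :=
  Function.invFunOn M.generator M.allLatent

/-- The content-style model: content and style spaces are open and simply connected, the generator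
is differentiable and injective on the latent space, and in every domain the latent pair is a random
point of the latent space of that domain, with a content distribution shared by all domains. Content
and style may be dependent. -/
structure IsContentStyle (M : Model ι dC dS d) : Prop where
  isOpen_content : IsOpen M.content
  simplyConnected_content : SimplyConnectedSpace M.content
  isOpen_style : ∀ n, IsOpen (M.style n)
  simplyConnected_style : ∀ n, SimplyConnectedSpace (M.style n)
  differentiable : DifferentiableOn ℝ M.generator M.allLatent
  injective : InjOn M.generator M.allLatent
  isProbability : ∀ n, IsProbabilityMeasure (M.law n)
  law_latent : ∀ n, ∀ᵐ z ∂(M.law n), z ∈ M.latent n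
  shared_content : ∀ i j, (M.law i).fst = (M.law j).fst

/-- Every latent pair has a regular (finite and strictly positive) density on its latent space. -/
def HasRegularDensity (M : Model ι dC dS d) : Prop :=
  ∀ n, ∃ p : Vec dC × Vec dS → ENNReal, Measurable p ∧
    (∀ z ∈ M.latent n, 0 < p z ∧ p z < ⊤) ∧
    M.law n = (volume.restrict (M.latent n)).withDensity p

/-- Domain variability: every measurable set `A` of latent points that has positive probability in
every domain and is not, up to sets that are null in every domain, of the form `B × S` with `B` a set
of contents, is told apart by some pair of domains. -/
def DomainVariability (M : Model ι dC dS d) : Prop :=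
  ∀ A : Set (Vec dC × Vec dS), MeasurableSet A → A ⊆ M.allLatent →
    (∀ n, 0 < M.law n A) →
    (¬ ∃ B ⊆ M.content, ∀ n, M.law n (symmDiff A (B ×ˢ M.allStyle)) = 0) →
    ∃ i j, M.law i A ≠ M.law j A

/-- Inexact differential independence with slack `ξ`: at every latent point, the smallest principal
angle between the content and style tangent subspaces is at least `π / 2 - ξ`. -/
def InexactIndependence (M : Model ι dC dS d) (ξ : ℝ) : Prop :=
  ∀ n, ∀ z ∈ M.latent n,
    Real.pi / 2 - ξ ≤
      smallestPrincipalAngle (jacRange (contentJac M.generator z))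
        (jacRange (styleJac M.generator z))

/-- At every latent point, the style Jacobian has rank `dS`. -/
def FullStyleRank (M : Model ι dC dS d) : Prop :=
  ∀ n, ∀ z ∈ M.latent n, Module.finrank ℝ (jacRange (styleJac M.generator z)) = dS

/-- `L` solves the learning problem for data generated by `M`: it is itself a content-style model,
its generator is invertible from the latent space onto the data manifold of each domain, with a
differentiable inverse, it reproduces the data distribution of each domain, and its content and style
tangent subspaces are orthogonal. -/
structure IsSolution (L M : Model ι dC dS d) : Prop where
  model : L.IsContentStyle
  data_eq : ∀ n, L.data n = M.data n
  differentiable_inverse : DifferentiableOn ℝ L.inverse L.allData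
  distribution_matching : ∀ n, (M.law n).map M.generator = (L.law n).map L.generator
  orthogonal : ∀ n, ∀ z ∈ L.latent n,
    jacRange (contentJac L.generator z) ⟂ jacRange (styleJac L.generator z)

/-- The latent point that `L` extracts from the data point generated by `M` at the latent point `z`;
its components are the learned content and the learned style. -/
def learned (L M : Model ι dC dS d) (z : Vec dC × Vec dS) : Vec dC × Vec dS :=
  L.inverse (M.generator z)

end Model

end ContentStyle

end

/-! The learned content, as a function of the true latents, has the same law in every domain, by
distribution matching. Domain variability therefore makes each event "learned content in an open
set" a cylinder up to null sets (`exists_cylinder`). If one content had two learned values, disjoint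
neighbourhoods of these would give two boxes over that content, one almost inside and one almost
outside the same cylinder; the positive density forbids this (`learned_content_eq`).

The style derivative of the learned content thus vanishes, so `J_s g = J_ŝ ĝ · J_s δ`. Full rank
makes `J_s δ` invertible, and the style ranges of `g` and `ĝ` agree. Injectivity of `γ` follows from
connectedness of the learned style space, once each fixed-content slice is known to have an open
style image.

For the bound, write `J_c g v = a + b` with `a` in the content range and `b = J_ŝ ĝ (J_c δ v)` in
the style range of `ĝ`. Orthogonality gives `‖b‖² = ⟨J_c g v, b⟩ ≤ sin ξ ‖J_c g v‖ ‖b‖`, while `‖b‖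
≥ σ_min ‖J_c δ v‖`. -/

noncomputable section

open MeasureTheory Set

namespace ContentStyle

/-- The image of an open set under an injective map whose derivative is onto at every point is open.
The derivative need not be continuous. -/
theorem isOpen_image_of_injOn_of_surjective_fderiv {E F : Type*}
    [NormedAddCommGroup E] [InnerProductSpace ℝ E] [FiniteDimensional ℝ E]
    [NormedAddCommGroup F] [InnerProductSpace ℝ F] {f : E → F} {f' : E → E →L[ℝ] F} {U : Set E}
    (hU : IsOpen U) (hinj : InjOn f U) (hf : ∀ x ∈ U, HasFDerivAt f (f' x) x)
    (hsurj : ∀ x ∈ U, Function.Surjective (f' x)) : IsOpen (f '' U) := by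
  have := FiniteDimensional.proper_real E
  rw [Metric.isOpen_iff]
  rintro _ ⟨x₀, hx₀, rfl⟩
  obtain ⟨r, hr, hrU⟩ := Metric.nhds_basis_closedBall.mem_iff.1 (hU.mem_nhds hx₀)
  have hcont : ContinuousOn f (Metric.closedBall x₀ r) := fun x hx =>
    (hf x (hrU hx)).continuousAt.continuousWithinAt
  obtain ⟨m, hm, hsphere⟩ : ∃ m > 0, ∀ x ∈ Metric.sphere x₀ r, m ≤ dist (f x) (f x₀) := by
    -- The sphere is empty when `E` is trivial; any positive `m` then works.
    rcases (Metric.sphere x₀ r).eq_empty_or_nonempty with he | hne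
    · exact ⟨1, one_pos, by simp [he]⟩
    obtain ⟨x, hx, hmin⟩ := (isCompact_sphere x₀ r).exists_isMinOn hne
      (f := fun x => dist (f x) (f x₀))
      (continuous_dist.comp_continuousOn
        ((hcont.mono Metric.sphere_subset_closedBall).prodMk continuousOn_const))
    refine ⟨dist (f x) (f x₀), dist_pos.2 fun h => ?_, fun y hy => hmin hy⟩
    have hxx : x = x₀ := hinj (hrU (Metric.sphere_subset_closedBall hx)) hx₀ h
    rw [hxx, Metric.mem_sphere, dist_self] at hx
    exact hr.ne hx
  -- For `y` within `m / 2` of `f x₀`, a minimiser of `‖f x - y‖` on the closed ball cannot lie on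
  -- the sphere, by the triangle inequality. At an interior minimiser of the square, `f x - y` is
  -- orthogonal to the range of the derivative, which is everything.
  refine ⟨m / 2, half_pos hm, fun y hy => ?_⟩
  rw [Metric.mem_ball] at hy
  obtain ⟨x, hx, hmin⟩ := (isCompact_closedBall x₀ r).exists_isMinOn
    ⟨x₀, Metric.mem_closedBall_self hr.le⟩ (f := fun x => ‖f x - y‖ ^ 2)
    ((hcont.sub continuousOn_const).norm.pow 2)
  have hle : ‖f x - y‖ ≤ ‖f x₀ - y‖ :=
    (sq_le_sq₀ (norm_nonneg _) (norm_nonneg _)).1 (hmin (Metric.mem_closedBall_self hr.le))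
  have hxball : x ∈ Metric.ball x₀ r := by
    refine Metric.mem_ball.2 (lt_of_le_of_ne (Metric.mem_closedBall.1 hx) fun h => ?_)
    have h1 := hsphere x h
    have h2 := dist_triangle (f x) y (f x₀)
    rw [← dist_eq_norm, ← dist_eq_norm, dist_comm (f x₀) y] at hle
    linarith
  have hloc : IsLocalMin (fun x => ‖f x - y‖ ^ 2) x :=
    hmin.isLocalMin (Filter.mem_of_superset (Metric.isOpen_ball.mem_nhds hxball)
      Metric.ball_subset_closedBall)
  have hzero := hloc.hasFDerivAt_eq_zero ((hf x (hrU hx)).sub_const y).norm_sq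
  obtain ⟨v, hv⟩ := hsurj x (hrU hx) (f x - y)
  refine ⟨x, hrU hx, ?_⟩
  have h := congrArg (fun φ : E →L[ℝ] ℝ => φ v) hzero
  have hinner : inner ℝ (f x - y) (f x - y) = 0 := by
    rw [inner_sub_left]
    simpa [hv] using h
  exact sub_eq_zero.1 (inner_self_eq_zero.1 hinner)

/-! ### Singular values and principal angles -/

/-- The smallest singular value bounds a linear map from below. -/
theorem sigmaMin_mul_norm_le {p r : ℕ} (J : Vec p →L[ℝ] Vec r) (v : Vec p) :
    sigmaMin J * ‖v‖ ≤ ‖J v‖ := by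
  rcases Nat.eq_zero_or_pos p with rfl | hp
  · simp [Subsingleton.elim v 0]
  set T : Vec p →ₗ[ℝ] Vec r := (J : Vec p →ₗ[ℝ] Vec r) with hT
  have hn : Module.finrank ℝ (Vec p) = p := by simp
  -- In an eigenbasis of `T* T`, `‖T v‖²` is a sum of squared coordinates weighted by squared
  -- singular values; the last weight is the least.
  have hS := T.isSymmetric_adjoint_comp_self
  set b := hS.eigenvectorBasis hn with hb
  have hpos : 0 ≤ sigmaMin J := T.singularValues_nonneg _
  refine (sq_le_sq₀ (by positivity) (norm_nonneg _)).1 ?_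
  have h1 : ‖J v‖ ^ 2 = ∑ i, hS.eigenvalues hn i * (b.repr v i) ^ 2 := by
    have : ‖J v‖ ^ 2 = inner ℝ v ((LinearMap.adjoint T ∘ₗ T) v) := by
      rw [LinearMap.comp_apply, LinearMap.adjoint_inner_right, real_inner_self_eq_norm_sq]
      rfl
    rw [this, ← b.repr.inner_map_map, PiLp.inner_apply]
    refine Finset.sum_congr rfl fun i _ => ?_
    rw [hb, hS.eigenvectorBasis_apply_self_apply hn v i]
    simp
    ring
  have h2 : ‖v‖ ^ 2 = ∑ i, (b.repr v i) ^ 2 := by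
    rw [← b.repr.norm_map, EuclideanSpace.norm_sq_eq]
    simp
  rw [mul_pow, h1, h2, Finset.mul_sum]
  refine Finset.sum_le_sum fun i _ => mul_le_mul_of_nonneg_right ?_ (sq_nonneg _)
  rw [sigmaMin, ← hT, T.sq_singularValues_of_lt hn (Nat.sub_lt hp one_pos)]
  exact hS.eigenvalues_antitone hn (Fin.le_def.2 (Nat.le_sub_one_of_lt i.isLt))

theorem sigmaMin_pos {p r : ℕ} {J : Vec p →L[ℝ] Vec r} (hJ : Function.Injective J) (hp : 0 < p) :
    0 < sigmaMin J := by
  refine (LinearMap.injective_iff_forall_lt_finrank_singularValues_pos _).1 hJ _ ?_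
  simp only [finrank_euclideanSpace, Fintype.card_fin]
  omega

/-- Vectors of two subspaces make at least the smallest principal angle of the subspaces. -/
theorem smallestPrincipalAngle_le_angle {r : ℕ} {U V : Submodule ℝ (Vec r)} {u v : Vec r}
    (hu : u ∈ U) (hv : v ∈ V) (hu0 : u ≠ 0) (hv0 : v ≠ 0) :
    smallestPrincipalAngle U V ≤ InnerProductGeometry.angle u v := by
  refine csInf_le ⟨0, ?_⟩ (mem_insert_of_mem _ ⟨u, hu, v, hv, hu0, hv0, rfl⟩)
  rintro θ (rfl | ⟨u, -, v, -, -, -, rfl⟩)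
  · positivity
  · exact InnerProductGeometry.angle_nonneg _ _

/-- Cosine decreases on `[0, π]` and `cos (π / 2 - ξ) = sin ξ`; the condition `ξ ≤ π / 2` keeps the
angle bound in that interval. -/
theorem inner_le_sin_mul_norm_mul_norm {r : ℕ} {U V : Submodule ℝ (Vec r)} {ξ : ℝ}
    (hξ : ξ ∈ Icc 0 (Real.pi / 2)) (hangle : Real.pi / 2 - ξ ≤ smallestPrincipalAngle U V)
    {u v : Vec r} (hu : u ∈ U) (hv : v ∈ V) : inner ℝ u v ≤ Real.sin ξ * (‖u‖ * ‖v‖) := by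
  rcases eq_or_ne u 0 with rfl | hu0
  · simp
  rcases eq_or_ne v 0 with rfl | hv0
  · simp
  rw [← InnerProductGeometry.cos_angle_mul_norm_mul_norm, ← Real.cos_pi_div_two_sub]
  refine mul_le_mul_of_nonneg_right ?_ (by positivity)
  exact Real.cos_le_cos_of_nonneg_of_le_pi (by linarith [hξ.2])
    (InnerProductGeometry.angle_le_pi _ _)
    (hangle.trans (smallestPrincipalAngle_le_angle hu hv hu0 hv0))

/-! ### Partial Jacobians as restrictions of the full derivative -/

theorem hasFDerivAt_content {p q r : ℕ} {F : Vec p × Vec q → Vec r} {z : Vec p × Vec q}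
    {F' : Vec p × Vec q →L[ℝ] Vec r} (hF : HasFDerivAt F F' z) :
    HasFDerivAt (fun c => F (c, z.2)) (F'.comp (ContinuousLinearMap.inl ℝ (Vec p) (Vec q))) z.1 :=
  HasFDerivAt.comp z.1 (g := F) (f := fun c => (c, z.2)) hF (hasFDerivAt_prodMk_left z.1 z.2)

theorem hasFDerivAt_style {p q r : ℕ} {F : Vec p × Vec q → Vec r} {z : Vec p × Vec q}
    {F' : Vec p × Vec q →L[ℝ] Vec r} (hF : HasFDerivAt F F' z) :
    HasFDerivAt (fun s => F (z.1, s)) (F'.comp (ContinuousLinearMap.inr ℝ (Vec p) (Vec q))) z.2 :=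
  HasFDerivAt.comp z.2 (g := F) (f := fun s => (z.1, s)) hF (hasFDerivAt_prodMk_right z.1 z.2)

theorem contentJac_apply {p q r : ℕ} {F : Vec p × Vec q → Vec r} {z : Vec p × Vec q}
    {F' : Vec p × Vec q →L[ℝ] Vec r} (hF : HasFDerivAt F F' z) (v : Vec p) :
    contentJac F z v = F' (v, 0) := by
  rw [contentJac, (hasFDerivAt_content hF).fderiv]
  simp

theorem styleJac_apply {p q r : ℕ} {F : Vec p × Vec q → Vec r} {z : Vec p × Vec q}
    {F' : Vec p × Vec q →L[ℝ] Vec r} (hF : HasFDerivAt F F' z) (w : Vec q) :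
    styleJac F z w = F' (0, w) := by
  rw [styleJac, (hasFDerivAt_style hF).fderiv]
  simp

namespace Model

variable {ι : Type*} {dC dS d : ℕ} {L M : Model ι dC dS d}

theorem allLatent_eq_iUnion (M : Model ι dC dS d) : M.allLatent = ⋃ n, M.latent n :=
  prod_iUnion

theorem latent_subset_allLatent (M : Model ι dC dS d) (n : ι) : M.latent n ⊆ M.allLatent := by
  rw [allLatent_eq_iUnion]
  exact subset_iUnion M.latent n

theorem allData_eq_iUnion (M : Model ι dC dS d) : M.allData = ⋃ n, M.data n := by
  rw [allData, allLatent_eq_iUnion, image_iUnion]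
  rfl

namespace IsContentStyle

theorem isOpen_latent (hM : M.IsContentStyle) (n : ι) : IsOpen (M.latent n) :=
  hM.isOpen_content.prod (hM.isOpen_style n)

theorem isOpen_allLatent (hM : M.IsContentStyle) : IsOpen M.allLatent :=
  hM.isOpen_content.prod (isOpen_iUnion hM.isOpen_style)

theorem style_nonempty (hM : M.IsContentStyle) (n : ι) : (M.style n).Nonempty :=
  have := hM.simplyConnected_style n
  nonempty_coe_sort.1 inferInstance

theorem isPreconnected_style (hM : M.IsContentStyle) (n : ι) : IsPreconnected (M.style n) :=
  have := hM.simplyConnected_style n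
  isPreconnected_iff_preconnectedSpace.2 inferInstance

theorem hasFDerivAt_generator (hM : M.IsContentStyle) {z : Vec dC × Vec dS}
    (hz : z ∈ M.allLatent) : HasFDerivAt M.generator (fderiv ℝ M.generator z) z :=
  (hM.differentiable.differentiableAt (hM.isOpen_allLatent.mem_nhds hz)).hasFDerivAt

theorem ae_mem_allLatent (hM : M.IsContentStyle) (n : ι) : ∀ᵐ z ∂(M.law n), z ∈ M.allLatent :=
  (hM.law_latent n).mono fun _ hz => M.latent_subset_allLatent n hz

theorem aemeasurable_generator (hM : M.IsContentStyle) (n : ι) :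
    AEMeasurable M.generator (M.law n) := by
  rw [← Measure.restrict_eq_self_of_ae_mem (hM.ae_mem_allLatent n)]
  exact hM.differentiable.continuousOn.aemeasurable hM.isOpen_allLatent.measurableSet

theorem inverse_generator (hM : M.IsContentStyle) {z : Vec dC × Vec dS} (hz : z ∈ M.allLatent) :
    M.inverse (M.generator z) = z :=
  hM.injective.leftInvOn_invFunOn hz

end IsContentStyle

/-- With a positive density, sets that are null for the law of a domain are Lebesgue null within
the latent space of the domain. -/
theorem HasRegularDensity.volume_inter_latent_eq_zero (hdens : M.HasRegularDensity)
    (hM : M.IsContentStyle) {n : ι} {A : Set (Vec dC × Vec dS)} (hA : M.law n A = 0) :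
    volume (A ∩ M.latent n) = 0 := by
  obtain ⟨p, hp, hpos, hlaw⟩ := hdens n
  rw [hlaw, withDensity_apply_eq_zero hp,
    Measure.restrict_apply' (hM.isOpen_latent n).measurableSet] at hA
  refine measure_mono_null (fun z hz => ?_) hA
  exact ⟨⟨(hpos z hz.2).1.ne', hz.1⟩, hz.2⟩

theorem FullStyleRank.injective_styleJac (hrank : M.FullStyleRank) {n : ι} {z : Vec dC × Vec dS}
    (hz : z ∈ M.latent n) : Function.Injective (styleJac M.generator z) := by
  have h := LinearMap.finrank_range_add_finrank_ker
    (styleJac M.generator z : Vec dS →ₗ[ℝ] Vec d)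
  have hr := hrank n z hz
  rw [jacRange] at hr
  rw [hr, finrank_euclideanSpace, Fintype.card_fin] at h
  exact LinearMap.ker_eq_bot.1 (Submodule.finrank_eq_zero.1 (by omega))

/-! ### The learned latent map and identification of content -/

namespace IsSolution

theorem allData_eq (hL : L.IsSolution M) : L.allData = M.allData := by
  simp only [allData_eq_iUnion, hL.data_eq]

theorem mapsTo_generator (hL : L.IsSolution M) : MapsTo M.generator M.allLatent L.allData := by
  rw [hL.allData_eq]
  exact mapsTo_image _ _

theorem generator_learned (hL : L.IsSolution M) {z : Vec dC × Vec dS} (hz : z ∈ M.allLatent) :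
    L.generator (L.learned M z) = M.generator z :=
  Function.invFunOn_eq (hL.mapsTo_generator hz)

theorem learned_mem_latent (hL : L.IsSolution M) {n : ι} {z : Vec dC × Vec dS}
    (hz : z ∈ M.latent n) : L.learned M z ∈ L.latent n := by
  have hx : M.generator z ∈ L.data n := by
    rw [hL.data_eq n]
    exact mem_image_of_mem _ hz
  obtain ⟨w, hw, hwz⟩ := hx
  rwa [learned, ← hwz, hL.model.inverse_generator (L.latent_subset_allLatent n hw)]

theorem exists_learned_eq (hL : L.IsSolution M) {n : ι} {w : Vec dC × Vec dS}
    (hw : w ∈ L.latent n) : ∃ z ∈ M.latent n, L.learned M z = w := by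
  have hx : L.generator w ∈ M.data n := by
    rw [← hL.data_eq n]
    exact mem_image_of_mem _ hw
  obtain ⟨z, hz, hzw⟩ := hx
  exact ⟨z, hz, by
    rw [learned, hzw, hL.model.inverse_generator (L.latent_subset_allLatent n hw)]⟩

theorem injOn_learned (hL : L.IsSolution M) (hM : M.IsContentStyle) :
    InjOn (L.learned M) M.allLatent := fun z hz w hw h =>
  hM.injective hz hw (by rw [← hL.generator_learned hz, h, hL.generator_learned hw])

theorem differentiableAt_learned (hL : L.IsSolution M) (hM : M.IsContentStyle)
    {z : Vec dC × Vec dS} (hz : z ∈ M.allLatent) : DifferentiableAt ℝ (L.learned M) z :=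
  (hL.differentiable_inverse.comp hM.differentiable hL.mapsTo_generator).differentiableAt
    (hM.isOpen_allLatent.mem_nhds hz)

/-- The true generator is the learned generator composed with the learned latent map, so their
derivatives obey the chain rule. -/
theorem fderiv_generator_apply (hL : L.IsSolution M) (hM : M.IsContentStyle)
    {n : ι} {z : Vec dC × Vec dS} (hz : z ∈ M.latent n) (v : Vec dC × Vec dS) :
    fderiv ℝ M.generator z v =
      fderiv ℝ L.generator (L.learned M z) (fderiv ℝ (L.learned M) z v) := by
  have hz' := M.latent_subset_allLatent n hz
  have h := (hL.model.hasFDerivAt_generator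
    (L.latent_subset_allLatent n (hL.learned_mem_latent hz))).comp z
    (hL.differentiableAt_learned hM hz').hasFDerivAt
  have heq : M.generator =ᶠ[nhds z] L.generator ∘ L.learned M := by
    filter_upwards [hM.isOpen_allLatent.mem_nhds hz'] with w hw
    exact (hL.generator_learned hw).symm
  rw [(h.congr_of_eventuallyEq heq).fderiv]
  rfl

/-- The learned content has the same distribution in all domains. -/
theorem law_learned_content_eq (hL : L.IsSolution M) (hM : M.IsContentStyle) {B : Set (Vec dC)}
    (hB : IsOpen B) (i j : ι) :
    M.law i (M.allLatent ∩ {z | (L.learned M z).1 ∈ B}) =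
      M.law j (M.allLatent ∩ {z | (L.learned M z).1 ∈ B}) := by
  -- The learned inverse is controlled only on the data manifold, so the event is the trace there of
  -- an ambient open set `O`, whose probability can be compared under the two push-forward laws.
  obtain ⟨O, hO, hOB⟩ := continuousOn_iff'.1
    (continuous_fst.comp_continuousOn hL.differentiable_inverse.continuousOn) B hB
  have key : ∀ n, M.law n (M.allLatent ∩ {z | (L.learned M z).1 ∈ B}) = (L.law n).fst B := by
    intro n
    have h1 : M.law n (M.allLatent ∩ {z | (L.learned M z).1 ∈ B}) =
        M.law n (M.generator ⁻¹' O) := by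
      refine measure_congr ?_
      filter_upwards [hM.ae_mem_allLatent n] with z hz
      have := Set.ext_iff.1 hOB (M.generator z)
      simp only [mem_inter_iff, hL.mapsTo_generator hz, and_true] at this
      exact propext ⟨fun h => this.1 h.2, fun h => ⟨hz, this.2 h⟩⟩
    have h2 : L.law n (L.generator ⁻¹' O) = L.law n (Prod.fst ⁻¹' B) := by
      refine measure_congr ?_
      filter_upwards [hL.model.ae_mem_allLatent n] with z hz
      have := Set.ext_iff.1 hOB (L.generator z)
      simp only [mem_inter_iff, mem_preimage, Function.comp_apply, hL.model.inverse_generator hz,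
        show L.generator z ∈ L.allData from mem_image_of_mem _ hz, and_true] at this
      exact propext this.symm
    rw [h1, ← Measure.map_apply_of_aemeasurable (hM.aemeasurable_generator n) hO.measurableSet,
      hL.distribution_matching n,
      Measure.map_apply_of_aemeasurable (hL.model.aemeasurable_generator n) hO.measurableSet, h2,
      Measure.fst_apply hB.measurableSet]
  rw [key, key, hL.model.shared_content i j]

/-- Latent points with learned content in a given open set form, up to null sets, a cylinder over a
set of contents. -/
theorem exists_cylinder (hL : L.IsSolution M) (hM : M.IsContentStyle)
    (hvar : M.DomainVariability) {B : Set (Vec dC)} (hB : IsOpen B) :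
    ∃ D : Set (Vec dC), ∀ n, M.law n
      (symmDiff (M.allLatent ∩ {z | (L.learned M z).1 ∈ B}) (D ×ˢ M.allStyle)) = 0 := by
  have hopen : IsOpen (M.allLatent ∩ {z | (L.learned M z).1 ∈ B}) := by
    refine ContinuousOn.isOpen_inter_preimage (f := fun z => (L.learned M z).1) (fun z hz => ?_)
      hM.isOpen_allLatent hB
    exact (hL.differentiableAt_learned hM hz).continuousAt.fst.continuousWithinAt
  by_cases hpos : ∀ n, 0 < M.law n (M.allLatent ∩ {z | (L.learned M z).1 ∈ B})
  · by_contra hcon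
    obtain ⟨i, j, hij⟩ := hvar _ hopen.measurableSet inter_subset_left hpos
      fun ⟨D, _, hD⟩ => hcon ⟨D, hD⟩
    exact hij (hL.law_learned_content_eq hM hB i j)
  -- The event has equal probability in all domains, so null in one means null in all, and the empty
  -- cylinder serves.
  · push Not at hpos
    obtain ⟨i, hi⟩ := hpos
    refine ⟨∅, fun n => ?_⟩
    rw [empty_prod, ← bot_eq_empty, symmDiff_bot, hL.law_learned_content_eq hM hB n i]
    exact le_antisymm hi zero_le

/-- The learned content depends on the true content only. -/
theorem learned_content_eq (hL : L.IsSolution M) (hM : M.IsContentStyle)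
    (hdens : M.HasRegularDensity) (hvar : M.DomainVariability) {c : Vec dC} {s t : Vec dS}
    (hs : (c, s) ∈ M.allLatent) (ht : (c, t) ∈ M.allLatent) :
    (L.learned M (c, s)).1 = (L.learned M (c, t)).1 := by
  by_contra hne
  obtain ⟨B, B', hB, hB', hsB, htB', hdisj⟩ := t2_separation hne
  obtain ⟨D, hD⟩ := hL.exists_cylinder hM hvar hB
  have box : ∀ {s : Vec dS} {B : Set (Vec dC)}, IsOpen B → (c, s) ∈ M.allLatent →
      (L.learned M (c, s)).1 ∈ B → ∃ n, ∃ U : Set (Vec dC), ∃ V : Set (Vec dS),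
        U ∈ nhds c ∧ V ∈ nhds s ∧ U ×ˢ V ⊆ M.latent n ∩ {z | (L.learned M z).1 ∈ B} := by
    intro s B hB hs hsB
    have hs' := hs
    rw [allLatent_eq_iUnion, mem_iUnion] at hs'
    obtain ⟨n, hn⟩ := hs'
    have hcont : ContinuousAt (fun z => (L.learned M z).1) (c, s) :=
      (hL.differentiableAt_learned hM hs).continuousAt.fst
    have hnhds := Filter.inter_mem ((hM.isOpen_latent n).mem_nhds hn)
      (hcont.preimage_mem_nhds (hB.mem_nhds hsB))
    rw [mem_nhds_prod_iff] at hnhds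
    obtain ⟨U, hU, V, hV, hUV⟩ := hnhds
    exact ⟨n, U, V, hU, hV, hUV⟩
  have null : ∀ {n : ι} {W : Set (Vec dC)} {V : Set (Vec dS)} {s : Vec dS}, V ∈ nhds s →
      W ×ˢ V ⊆ symmDiff (M.allLatent ∩ {z | (L.learned M z).1 ∈ B}) (D ×ˢ M.allStyle) →
      W ×ˢ V ⊆ M.latent n → volume W = 0 := by
    intro n W V s hV hW hlat
    have h := measure_mono_null (subset_inter hW hlat)
      (hdens.volume_inter_latent_eq_zero hM (hD n))
    rw [Measure.volume_eq_prod, Measure.prod_prod, mul_eq_zero] at h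
    exact h.resolve_right (Measure.measure_pos_of_mem_nhds volume hV).ne'
  -- The two styles may belong to different domains; one `D` serves both because the cylinder does
  -- not depend on the domain.
  obtain ⟨n, U, V, hU, hV, hUV⟩ := box hB hs hsB
  obtain ⟨n', U', V', hU', hV', hUV'⟩ := box hB' ht htB'
  have h1 : volume (U \ D) = 0 := by
    refine null (n := n) hV (fun z hz => Or.inl ?_) fun z hz => (hUV ⟨hz.1.1, hz.2⟩).1
    have hz' := hUV ⟨hz.1.1, hz.2⟩
    exact ⟨⟨M.latent_subset_allLatent n hz'.1, hz'.2⟩, fun h => hz.1.2 h.1⟩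
  have h2 : volume (U' ∩ D) = 0 := by
    refine null (n := n') hV' (fun z hz => Or.inr ?_) fun z hz => (hUV' ⟨hz.1.1, hz.2⟩).1
    have hz' := hUV' ⟨hz.1.1, hz.2⟩
    exact ⟨⟨hz.1.2, (M.latent_subset_allLatent n' hz'.1).2⟩,
      fun h => disjoint_left.1 hdisj h.2 hz'.2⟩
  refine (Measure.measure_pos_of_mem_nhds volume (Filter.inter_mem hU hU')).ne'
    (measure_mono_null (fun x hx => ?_) (measure_union_null h1 h2))
  by_cases hxD : x ∈ D
  · exact Or.inr ⟨hx.2, hxD⟩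
  · exact Or.inl ⟨hx.1, hxD⟩

/-- The derivative of the learned content in the style directions vanishes. -/
theorem fderiv_learned_style_fst (hL : L.IsSolution M) (hM : M.IsContentStyle)
    (hdens : M.HasRegularDensity) (hvar : M.DomainVariability) {z : Vec dC × Vec dS}
    (hz : z ∈ M.allLatent) (w : Vec dS) : (fderiv ℝ (L.learned M) z (0, w)).1 = 0 := by
  have h := ((hL.differentiableAt_learned hM hz).hasFDerivAt.fst).comp z.2
    (f := fun s => (z.1, s)) (hasFDerivAt_prodMk_right z.1 z.2)
  have hconst : (fun s => (L.learned M (z.1, s)).1) =ᶠ[nhds z.2]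
      fun _ => (L.learned M z).1 := by
    filter_upwards [(isOpen_iUnion hM.isOpen_style).mem_nhds hz.2] with s hs
    exact hL.learned_content_eq hM hdens hvar ⟨hz.1, hs⟩ hz
  have h0 := (hasFDerivAt_const (𝕜 := ℝ) (L.learned M z).1 z.2).congr_of_eventuallyEq hconst
  simpa using congrArg (fun φ : Vec dS →L[ℝ] Vec dC => φ w) (h.unique h0)

/-! ### Jacobians of the learned latent map and injectivity on contents -/

/-- Chain rule for the style Jacobian. -/
theorem styleJac_generator_apply (hL : L.IsSolution M) (hM : M.IsContentStyle)
    (hdens : M.HasRegularDensity) (hvar : M.DomainVariability) {n : ι} {z : Vec dC × Vec dS}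
    (hz : z ∈ M.latent n) (w : Vec dS) :
    styleJac M.generator z w =
      styleJac L.generator (L.learned M z) (styleJac (fun z => (L.learned M z).2) z w) := by
  have hz' := M.latent_subset_allLatent n hz
  have hlz := L.latent_subset_allLatent n (hL.learned_mem_latent hz)
  rw [styleJac_apply (hM.hasFDerivAt_generator hz'),
    styleJac_apply (hL.model.hasFDerivAt_generator hlz),
    styleJac_apply (hL.differentiableAt_learned hM hz').hasFDerivAt.snd,
    hL.fderiv_generator_apply hM hz]
  congr 1
  exact Prod.ext (hL.fderiv_learned_style_fst hM hdens hvar hz' w) rfl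

/-- Chain rule for the content Jacobian. -/
theorem contentJac_generator_apply (hL : L.IsSolution M) (hM : M.IsContentStyle) {n : ι}
    {z : Vec dC × Vec dS} (hz : z ∈ M.latent n) (v : Vec dC) :
    contentJac M.generator z v =
      contentJac L.generator (L.learned M z) (contentJac (fun z => (L.learned M z).1) z v) +
      styleJac L.generator (L.learned M z) (contentJac (fun z => (L.learned M z).2) z v) := by
  have hz' := M.latent_subset_allLatent n hz
  have hlz := L.latent_subset_allLatent n (hL.learned_mem_latent hz)
  have hd := (hL.differentiableAt_learned hM hz').hasFDerivAt
  rw [contentJac_apply (hM.hasFDerivAt_generator hz'),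
    contentJac_apply (hL.model.hasFDerivAt_generator hlz),
    styleJac_apply (hL.model.hasFDerivAt_generator hlz),
    contentJac_apply hd.fst, contentJac_apply hd.snd, hL.fderiv_generator_apply hM hz, ← map_add]
  simp

/-- It is the inner factor of the injective `J_s g`, hence injective, and it is square. -/
theorem bijective_styleJac_learned (hL : L.IsSolution M) (hM : M.IsContentStyle)
    (hdens : M.HasRegularDensity) (hvar : M.DomainVariability) (hrank : M.FullStyleRank) {n : ι}
    {z : Vec dC × Vec dS} (hz : z ∈ M.latent n) :
    Function.Bijective (styleJac (fun z => (L.learned M z).2) z) := by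
  have hinj : Function.Injective (styleJac (fun z => (L.learned M z).2) z) := fun v w h =>
    hrank.injective_styleJac hz (by
      rw [hL.styleJac_generator_apply hM hdens hvar hz, h,
        hL.styleJac_generator_apply hM hdens hvar hz])
  exact ⟨hinj, LinearMap.surjective_of_injective
    (f := (styleJac (fun z => (L.learned M z).2) z : Vec dS →ₗ[ℝ] Vec dS)) hinj⟩

theorem injective_styleJac_learned_generator (hL : L.IsSolution M) (hM : M.IsContentStyle)
    (hdens : M.HasRegularDensity) (hvar : M.DomainVariability) (hrank : M.FullStyleRank) {n : ι}
    {z : Vec dC × Vec dS} (hz : z ∈ M.latent n) :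
    Function.Injective (styleJac L.generator (L.learned M z)) := by
  have hbij := hL.bijective_styleJac_learned hM hdens hvar hrank hz
  intro v w h
  obtain ⟨v, rfl⟩ := hbij.2 v
  obtain ⟨w, rfl⟩ := hbij.2 w
  rw [← hL.styleJac_generator_apply hM hdens hvar hz,
    ← hL.styleJac_generator_apply hM hdens hvar hz] at h
  rw [hrank.injective_styleJac hz h]

/-- At fixed content, the learned styles of one domain form an open set. -/
theorem isOpen_image_learned_style (hL : L.IsSolution M) (hM : M.IsContentStyle)
    (hdens : M.HasRegularDensity) (hvar : M.DomainVariability) (hrank : M.FullStyleRank) (n : ι)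
    {c : Vec dC} (hc : c ∈ M.content) :
    IsOpen ((fun s => (L.learned M (c, s)).2) '' M.style n) := by
  have hmem : ∀ s ∈ M.style n, (c, s) ∈ M.allLatent := fun s hs =>
    M.latent_subset_allLatent n ⟨hc, hs⟩
  refine isOpen_image_of_injOn_of_surjective_fderiv
    (f' := fun s => styleJac (fun z => (L.learned M z).2) (c, s)) (hM.isOpen_style n)
    (fun s hs t ht h => ?_) (fun s hs => ?_)
    fun s hs => (hL.bijective_styleJac_learned hM hdens hvar hrank (z := (c, s)) ⟨hc, hs⟩).2
  -- At fixed content the learned content is constant, so equal learned styles mean equal learned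
  -- latents.
  · exact (Prod.mk.inj (hL.injOn_learned hM (hmem s hs) (hmem t ht) (Prod.ext
      (hL.learned_content_eq hM hdens hvar (hmem s hs) (hmem t ht)) h))).2
  · exact (hasFDerivAt_style (z := (c, s)) (hL.differentiableAt_learned hM
      (hmem s hs)).hasFDerivAt.snd).differentiableAt.hasFDerivAt

/-- Distinct contents have distinct learned contents: the styles learned over the contents with a
given learned content split the connected style space into disjoint open sets. -/
theorem content_eq_of_learned_content_eq (hL : L.IsSolution M) (hM : M.IsContentStyle)
    (hdens : M.HasRegularDensity) (hvar : M.DomainVariability) (hrank : M.FullStyleRank) {n : ι}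
    {z w : Vec dC × Vec dS} (hz : z ∈ M.latent n) (hw : w ∈ M.latent n)
    (h : (L.learned M z).1 = (L.learned M w).1) : z.1 = w.1 := by
  by_contra hne
  -- `I c` is the set of learned styles over `c`; `K` collects the contents other than `z.1` that
  -- share its learned content. Surjectivity of the learned map gives the cover, its injectivity the
  -- disjointness.
  let I : Vec dC → Set (Vec dS) := fun c => (fun s => (L.learned M (c, s)).2) '' M.style n
  let K : Set (Vec dC) := {c | c ∈ M.content ∧ c ≠ z.1 ∧
    ∀ s ∈ M.style n, (L.learned M (c, s)).1 = (L.learned M z).1}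
  have hIopen : ∀ c ∈ M.content, IsOpen (I c) := fun c hc =>
    hL.isOpen_image_learned_style hM hdens hvar hrank n hc
  have hmem : ∀ {c : Vec dC} {s : Vec dS}, c ∈ M.content → s ∈ M.style n →
      (c, s) ∈ M.allLatent := fun hc hs => M.latent_subset_allLatent n ⟨hc, hs⟩
  have hcover : L.style n ⊆ I z.1 ∪ ⋃ c ∈ K, I c := by
    intro t ht
    obtain ⟨y, hy, hyt⟩ := hL.exists_learned_eq (n := n) (w := ((L.learned M z).1, t))
      ⟨(hL.learned_mem_latent hz).1, ht⟩
    have hyI : t ∈ I y.1 := ⟨y.2, hy.2, congrArg Prod.snd hyt⟩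
    by_cases hyz : y.1 = z.1
    · exact Or.inl (hyz ▸ hyI)
    · refine Or.inr (mem_biUnion (show y.1 ∈ K from ⟨hy.1, hyz, fun s hs => ?_⟩) hyI)
      rw [hL.learned_content_eq hM hdens hvar (hmem hy.1 hs) (hmem hy.1 hy.2), Prod.mk.eta, hyt]
  have hdisj : Disjoint (I z.1) (⋃ c ∈ K, I c) := by
    rw [disjoint_left]
    rintro _ ⟨s, hs, rfl⟩ hmemK
    simp only [mem_iUnion] at hmemK
    obtain ⟨c, ⟨hc, hcz, hcs⟩, t, ht, heq⟩ := hmemK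
    refine hcz (Prod.mk.inj (hL.injOn_learned hM (hmem hc ht) (hmem hz.1 hs)
      (Prod.ext ?_ heq))).1
    rw [hcs t ht]
    exact hL.learned_content_eq hM hdens hvar (hmem hz.1 hz.2) (hmem hz.1 hs)
  have hstyle : ∀ y ∈ M.latent n, (L.learned M y).2 ∈ L.style n := fun y hy =>
    (hL.learned_mem_latent hy).2
  have hsub := (hL.model.isPreconnected_style n).subset_left_of_subset_union (hIopen z.1 hz.1)
    (isOpen_biUnion fun c hc => hIopen c hc.1) hdisj hcover
    ⟨(L.learned M z).2, hstyle z hz, z.2, hz.2, rfl⟩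
  have hwK : w.1 ∈ K := ⟨hw.1, fun hh => hne hh.symm, fun s hs => by
    rw [h]
    exact hL.learned_content_eq hM hdens hvar (hmem hw.1 hs) (hmem hw.1 hw.2)⟩
  exact disjoint_left.1 hdisj (hsub (hstyle w hw))
    (mem_biUnion hwK ⟨w.2, hw.2, rfl⟩)

/-! ### Angle estimate and conclusion -/

/-- The learned style varies with the content at most by the slack in differential independence,
relative to the smallest singular value of the learned style Jacobian. -/
theorem sigmaMin_mul_norm_contentJac_le (hL : L.IsSolution M) (hM : M.IsContentStyle)
    (hdens : M.HasRegularDensity) (hvar : M.DomainVariability) (hrank : M.FullStyleRank) {ξ : ℝ}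
    (hξ : ξ ∈ Icc 0 (Real.pi / 2)) (hangle : M.InexactIndependence ξ) {n : ι}
    {z : Vec dC × Vec dS} (hz : z ∈ M.latent n) (v : Vec dC) :
    sigmaMin (styleJac L.generator (L.learned M z)) *
        ‖contentJac (fun z => (L.learned M z).2) z v‖ ≤
      Real.sin ξ * ‖contentJac M.generator z v‖ := by
  refine (sigmaMin_mul_norm_le _ _).trans ?_
  set a := contentJac L.generator (L.learned M z) (contentJac (fun z => (L.learned M z).1) z v)
  set b := styleJac L.generator (L.learned M z) (contentJac (fun z => (L.learned M z).2) z v)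
  have hu : contentJac M.generator z v = a + b := hL.contentJac_generator_apply hM hz v
  have hab : inner ℝ a b = 0 :=
    (hL.orthogonal n _ (hL.learned_mem_latent hz)).inner_eq ⟨_, rfl⟩ ⟨_, rfl⟩
  -- The angle hypothesis concerns the true style range; `b` lies in it because `J_s δ` is onto.
  have hbmem : b ∈ jacRange (styleJac M.generator z) := by
    obtain ⟨w, hw⟩ := (hL.bijective_styleJac_learned hM hdens hvar hrank hz).2
      (contentJac (fun z => (L.learned M z).2) z v)
    refine ⟨w, ?_⟩
    rw [ContinuousLinearMap.coe_coe, hL.styleJac_generator_apply hM hdens hvar hz, hw]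
  have hle := inner_le_sin_mul_norm_mul_norm hξ (hangle n z hz)
    (u := contentJac M.generator z v) ⟨v, rfl⟩ hbmem
  have hbb : inner ℝ (contentJac M.generator z v) b = ‖b‖ * ‖b‖ := by
    rw [hu, inner_add_left, hab, zero_add, real_inner_self_eq_norm_mul_norm]
  have hsin : 0 ≤ Real.sin ξ := Real.sin_nonneg_of_nonneg_of_le_pi hξ.1 (by
    linarith [hξ.2, Real.pi_pos])
  rcases (norm_nonneg b).eq_or_lt with h0 | hpos
  · rw [← h0]
    positivity
  · refine le_of_mul_le_mul_right ?_ hpos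
    rw [← hbb, mul_assoc]
    exact hle

end IsSolution

end Model

end ContentStyle

end

theorem theorem2 {ι : Type*} [Nonempty ι] {dC dS d : ℕ}
    (M L : ContentStyle.Model ι dC dS d)
    (hM : M.IsContentStyle) (hdens : M.HasRegularDensity) (hvar : M.DomainVariability)
    (ξ : ℝ) (hξ : ξ ∈ Set.Icc 0 (Real.pi / 2))
    (hangle : M.InexactIndependence ξ) (hrank : M.FullStyleRank)
    (hL : L.IsSolution M) :
    (∃ γ : ContentStyle.Vec dC → ContentStyle.Vec dC,
      Set.BijOn γ M.content L.content ∧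
      ∀ n, ∀ z ∈ M.latent n, (L.learned M z).1 = γ z.1) ∧
    (∃ δ : ContentStyle.Vec dC × ContentStyle.Vec dS → ContentStyle.Vec dS,
      ∀ n, ∀ z ∈ M.latent n,
        δ z ∈ L.style n ∧
        (L.learned M z).2 = δ z ∧
        DifferentiableAt ℝ δ z ∧
        (0 < dS → 0 < ContentStyle.sigmaMin
          (ContentStyle.styleJac L.generator (L.learned M z))) ∧
        ‖ContentStyle.contentJac δ z‖ ≤
          Real.sin ξ /
              ContentStyle.sigmaMin (ContentStyle.styleJac L.generator (L.learned M z)) *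
            ‖ContentStyle.contentJac M.generator z‖) := by
  constructor
  · obtain ⟨n₀⟩ := ‹Nonempty ι›
    -- Any reference style defines `γ`, since the learned content does not depend on it.
    obtain ⟨s₀, hs₀⟩ := hM.style_nonempty n₀
    have hdep : ∀ n, ∀ z ∈ M.latent n, (L.learned M z).1 = (L.learned M (z.1, s₀)).1 :=
      fun n z hz => hL.learned_content_eq hM hdens hvar (M.latent_subset_allLatent n hz)
        (M.latent_subset_allLatent n₀ ⟨hz.1, hs₀⟩)
    refine ⟨fun c => (L.learned M (c, s₀)).1, ⟨fun c hc => ?_, fun c hc c' hc' h => ?_,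
      fun c' hc' => ?_⟩, hdep⟩
    · exact (hL.learned_mem_latent (n := n₀) ⟨hc, hs₀⟩).1
    · exact hL.content_eq_of_learned_content_eq hM hdens hvar hrank (n := n₀)
        (z := (c, s₀)) (w := (c', s₀)) ⟨hc, hs₀⟩ ⟨hc', hs₀⟩ h
    · obtain ⟨t, ht⟩ := hL.model.style_nonempty n₀
      obtain ⟨z, hz, hzc⟩ := hL.exists_learned_eq (n := n₀) (w := (c', t)) ⟨hc', ht⟩
      exact ⟨z.1, hz.1, (hdep n₀ z hz).symm.trans (congrArg Prod.fst hzc)⟩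
  · refine ⟨fun z => (L.learned M z).2, fun n z hz => ?_⟩
    have hpos : 0 < dS → 0 < ContentStyle.sigmaMin
        (ContentStyle.styleJac L.generator (L.learned M z)) :=
      ContentStyle.sigmaMin_pos
        (hL.injective_styleJac_learned_generator hM hdens hvar hrank hz)
    have hsin : 0 ≤ Real.sin ξ := Real.sin_nonneg_of_nonneg_of_le_pi hξ.1 (by
      linarith [hξ.2, Real.pi_pos])
    have hσ : 0 ≤ ContentStyle.sigmaMin
        (ContentStyle.styleJac L.generator (L.learned M z)) :=
      LinearMap.singularValues_nonneg _ _
    refine ⟨(hL.learned_mem_latent hz).2, rfl,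
      (hL.differentiableAt_learned hM (M.latent_subset_allLatent n hz)).snd, hpos, ?_⟩
    refine ContinuousLinearMap.opNorm_le_bound _ (by positivity) fun v => ?_
    -- For `dS = 0` the quotient by `sigmaMin` carries no information, but the left side is zero and
    -- the right side nonnegative.
    rcases Nat.eq_zero_or_pos dS with rfl | hdS
    · rw [Subsingleton.elim (ContentStyle.contentJac (fun z => (L.learned M z).2) z v) 0,
        norm_zero]
      positivity
    · rw [div_mul_eq_mul_div, div_mul_eq_mul_div, le_div_iff₀ (hpos hdS), mul_comm, mul_assoc]
      refine (hL.sigmaMin_mul_norm_contentJac_le hM hdens hvar hrank hξ hangle hz v).trans ?_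
      exact mul_le_mul_of_nonneg_left (ContinuousLinearMap.le_opNorm _ v) hsin
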